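/- Let $p$ be an odd prime, let $\gamma$ be a generator of $\mathbb{F}_{p^2}^{\times}$, let $k$ be a field of characteristic different from $p$, let $\bar k$ be a separable closure of $k$ (an algebraic closure if $k$ is perfect), and let $G_k=\operatorname{Gal}(\bar k/k)$. For a two-dimensional $\mathbb{F}_p$-vector space $V$, let $\mathcal C_\gamma\subset \operatorname{PGL}(V)$ be the conjugacy class of the elements that have a representative in $\operatorname{GL}(V)$ whose characteristic polynomial is the minimal polynomial of $\gamma$ over $\mathbb{F}_p$. An *oriented necklace* of an elliptic curve $E/\bar k$ is an equivalence class, up to cyclic permutation, of lists $(C_0,C_1,\dots,C_p)$ of all the $p+1$ cyclic subgroups of order $p$ of $E[p]$ for which there is an $h\in\mathcal C_\gamma\subset\operatorname{PGL}(E[p])$ with $h(C_i)=C_{i+1}$ for $0\le i<p$. A *necklace* is an orbit $\{\mathfrak v,w(\mathfrak v)\}$ of oriented necklaces under the reversal $w(C_0,\dots,C_p)=(C_p,\dots,C_0)$. Let $Y_{\mathrm{nsp}}(\bar k)$ (respectively $Y_{\mathrm{nsp}}^{+}(\bar k)$) be the set of $\bar k$-isomorphism classes of pairs $(E,\mathfrak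 v)$ of an elliptic curve $E/\bar k$ and an oriented necklace (respectively a necklace) $\mathfrak v$ of $E$. The group $G_k$ acts on these sets by $\sigma(E,\mathfrak v)=(E^\sigma,\sigma(\mathfrak v))$, where $\sigma$ is applied to each $C_i$; let $Y_{\mathrm{nsp}}(k)$ and $Y_{\mathrm{nsp}}^{+}(k)$ be the sets of points fixed by $G_k$. A *non-split Cartan subgroup* of $\operatorname{GL}(V)$ is the image of $\mathbb{F}_{p^2}^{\times}$, acting on $\mathbb{F}_{p^2}$ by multiplication, under some $\mathbb{F}_p$-linear identification $\mathbb{F}_{p^2}\cong V$. (1) Let $x\in Y_{\mathrm{nsp}}(k)$. Then there is a pair $(E,\mathfrak v)$ representing $x$ with $E$ defined over $k$. Moreover, for every pair $(E,\mathfrak v)$ representing $x$ with $E$ defined over $k$ and $j(E)\notin\{0,1728\}$, one has $\sigma(\mathfrak v)=\mathfrak v$ for all $\sigma\in G_k$, and the image of the Galois representation $\bar\rho_p(E)\colon G_k\to \operatorname{GL}(E[p])$ is contained in a non-split Cartan subgroup of $\operatorname{GL}(E[p])$. (2) Let $x\in Y_{\mathrm{nsp}}^{+}(k)$. Then there is a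 pair $(E,\mathfrak v)$ representing $x$ with $E$ defined over $k$. Moreover, for every pair $(E,\mathfrak v)$ representing $x$ with $E$ defined over $k$ and $j(E)\notin\{0,1728\}$, one has $\sigma(\mathfrak v)=\mathfrak v$ for all $\sigma\in G_k$, and the image of $\bar\rho_p(E)$ is contained in the normaliser of a non-split Cartan subgroup of $\operatorname{GL}(E[p])$. -/

import Mathlib

namespace Necklace

open WeierstrassCurve

section Points

variable {K : Type*} [Field K]

theorem nonsingular_variableChange (E : WeierstrassCurve K) (C : VariableChange K) (x y : K) :
    (C • E).toAffine.Nonsingular (C.u⁻¹ ^ 2 * (x - C.r))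
      (C.u⁻¹ ^ 3 * (y - C.s * (x - C.r) - C.t)) ↔ E.toAffine.Nonsingular x y := by
  have hv : ((C.u⁻¹ : Kˣ) : K) ≠ 0 := C.u⁻¹.ne_zero
  rw [Affine.nonsingular_iff', Affine.nonsingular_iff', Affine.equation_iff', Affine.equation_iff']
  simp only [variableChange_def]
  generalize ((C.u⁻¹ : Kˣ) : K) = v at *
  obtain ⟨u, r, s, t⟩ := C
  have h1 : ∀ (n : ℕ) {a b : K}, a = v ^ n * b → (a = 0 ↔ b = 0) := by
    rintro n a b rfl
    simp [hv]
  refine and_congr (h1 6 (by ring)) ?_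
  rw [← not_and_or, ← not_and_or, not_iff_not]
  have hY := h1 3 (a := 2 * (v ^ 3 * (y - s * (x - r) - t)) + v * (E.a₁ + 2 * s) *
    (v ^ 2 * (x - r)) + v ^ 3 * (E.a₃ + r * E.a₁ + 2 * t)) (b := 2 * y + E.a₁ * x + E.a₃) (by ring)
  rw [hY]
  refine and_congr_left fun hy => h1 4 ?_
  linear_combination v ^ 4 * s * hy

theorem negY_variableChange (E : WeierstrassCurve K) (C : VariableChange K) (x y : K) :
    (C • E).toAffine.negY (C.u⁻¹ ^ 2 * (x - C.r)) (C.u⁻¹ ^ 3 * (y - C.s * (x - C.r) - C.t)) =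
      C.u⁻¹ ^ 3 * (E.toAffine.negY x y - C.s * (x - C.r) - C.t) := by
  simp only [Affine.negY, variableChange_def]
  ring

theorem slope_variableChange [DecidableEq K] (E : WeierstrassCurve K) (C : VariableChange K)
    {x₁ x₂ y₁ y₂ : K} (h₁ : E.toAffine.Equation x₁ y₁) (h₂ : E.toAffine.Equation x₂ y₂)
    (hxy : ¬(x₁ = x₂ ∧ y₁ = E.toAffine.negY x₂ y₂)) :
    (C • E).toAffine.slope (C.u⁻¹ ^ 2 * (x₁ - C.r)) (C.u⁻¹ ^ 2 * (x₂ - C.r))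
      (C.u⁻¹ ^ 3 * (y₁ - C.s * (x₁ - C.r) - C.t)) (C.u⁻¹ ^ 3 * (y₂ - C.s * (x₂ - C.r) - C.t)) =
      C.u⁻¹ * (E.toAffine.slope x₁ x₂ y₁ y₂ - C.s) := by
  have hv : ((C.u⁻¹ : Kˣ) : K) ≠ 0 := C.u⁻¹.ne_zero
  by_cases hx : x₁ = x₂
  · have hy : y₁ ≠ E.toAffine.negY x₂ y₂ := fun h => hxy ⟨hx, h⟩
    obtain rfl := Affine.Y_eq_of_Y_ne h₁ h₂ hx hy
    subst hx
    rw [Affine.slope_of_Y_ne rfl hy, Affine.slope_of_Y_ne rfl, negY_variableChange]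
    · have hy' : y₁ - E.toAffine.negY x₁ y₁ ≠ 0 := sub_ne_zero.mpr hy
      have hd : ((C.u⁻¹ : Kˣ) : K) ^ 3 * (y₁ - C.s * (x₁ - C.r) - C.t) -
          C.u⁻¹ ^ 3 * (E.toAffine.negY x₁ y₁ - C.s * (x₁ - C.r) - C.t) =
          C.u⁻¹ ^ 3 * (y₁ - E.toAffine.negY x₁ y₁) := by ring
      rw [hd]
      have hn : E.toAffine.negY x₁ y₁ = -y₁ - E.a₁ * x₁ - E.a₃ := rfl
      rw [hn] at hy' ⊢
      simp only [variableChange_def]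
      generalize ((C.u⁻¹ : Kˣ) : K) = v at *
      rw [div_eq_iff (mul_ne_zero (pow_ne_zero 3 hv) hy'), div_sub' hy', mul_div_assoc',
        div_mul_eq_mul_div, eq_div_iff hy']
      ring
    · rw [negY_variableChange]
      intro h
      apply hy
      have := mul_left_cancel₀ (pow_ne_zero 3 hv) h
      linear_combination this
  · have hx' : x₁ - x₂ ≠ 0 := sub_ne_zero.mpr hx
    rw [Affine.slope_of_X_ne hx, Affine.slope_of_X_ne]
    · have hd : ((C.u⁻¹ : Kˣ) : K) ^ 2 * (x₁ - C.r) - C.u⁻¹ ^ 2 * (x₂ - C.r) =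
          C.u⁻¹ ^ 2 * (x₁ - x₂) := by ring
      rw [hd]
      generalize ((C.u⁻¹ : Kˣ) : K) = v at *
      field_simp
      ring
    · intro h
      apply hx
      have := mul_left_cancel₀ (pow_ne_zero 2 hv) h
      linear_combination this

/-- The isomorphism `(x, y) ↦ (u⁻²(x - r), u⁻³(y - s(x - r) - t))` from `E` to `C • E`, on points. -/
def changePoint {E E' : WeierstrassCurve K} (C : VariableChange K) (h : C • E = E') :
    E.toAffine.Point → E'.toAffine.Point
  | .zero => .zero
  | .some x y hxy => .some (C.u⁻¹ ^ 2 * (x - C.r)) (C.u⁻¹ ^ 3 * (y - C.s * (x - C.r) - C.t))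
      (h ▸ (nonsingular_variableChange E C x y).mpr hxy)

theorem changePoint_one {E E' : WeierstrassCurve K} (h : (1 : VariableChange K) • E = E')
    (h' : E = E') (P : E.toAffine.Point) : changePoint 1 h P = h' ▸ P := by
  subst h'
  cases P with
  | zero => rfl
  | some x y hxy => simp [changePoint, VariableChange.one_def]

theorem changePoint_changePoint {E E' E'' : WeierstrassCurve K} (C C' : VariableChange K)
    (h : C • E = E') (h' : C' • E' = E'') (h'' : (C' * C) • E = E'') (P : E.toAffine.Point) :
    changePoint C' h' (changePoint C h P) = changePoint (C' * C) h'' P := by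
  cases P with
  | zero => rfl
  | some x y hxy =>
    simp only [changePoint, VariableChange.mul_def, mul_inv, Units.val_mul, Affine.Point.some.injEq]
    have hu : ((C.u⁻¹ : Kˣ) : K) * (C.u : K) = 1 := C.u.inv_mul
    generalize ((C.u⁻¹ : Kˣ) : K) = v at *
    generalize ((C'.u⁻¹ : Kˣ) : K) = w at *
    generalize (C.u : K) = u at *
    constructor
    · linear_combination (w^2 * C'.r * (u * v + 1)) * hu
    · grind

/-- The isomorphism `E → C • E` as an isomorphism of groups of points. -/
noncomputable def changeHom [DecidableEq K] {E E' : WeierstrassCurve K} (C : VariableChange K)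
    (h : C • E = E') : E.toAffine.Point ≃+ E'.toAffine.Point where
  toFun := changePoint C h
  invFun := changePoint C⁻¹ (by rw [← h, inv_smul_smul])
  left_inv P := by
    rw [changePoint_changePoint (h'' := by rw [inv_mul_cancel, one_smul])]
    simp only [inv_mul_cancel]
    exact changePoint_one _ rfl P
  right_inv P := by
    rw [changePoint_changePoint (h'' := by rw [mul_inv_cancel, one_smul])]
    simp only [mul_inv_cancel]
    exact changePoint_one _ rfl P
  map_add' := by
    subst h
    have hv : ((C.u⁻¹ : Kˣ) : K) ≠ 0 := C.u⁻¹.ne_zero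
    rintro (_ | ⟨x₁, y₁, h₁⟩) (_ | ⟨x₂, y₂, h₂⟩)
    any_goals rfl
    by_cases hxy : x₁ = x₂ ∧ y₁ = E.toAffine.negY x₂ y₂
    · rw [Affine.Point.add_of_Y_eq hxy.left hxy.right]
      refine (Affine.Point.add_of_Y_eq (by rw [hxy.1]) ?_).symm
      rw [negY_variableChange, hxy.1, hxy.2]
    · rw [Affine.Point.add_some hxy]
      refine .trans ?_ (Affine.Point.add_some fun H => hxy ?_).symm
      · simp only [changePoint, Affine.Point.some.injEq]
        rw [slope_variableChange E C h₁.1 h₂.1 hxy]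
        generalize E.toAffine.slope x₁ x₂ y₁ y₂ = l
        simp only [Affine.addX, Affine.addY, Affine.negAddY, Affine.negY, variableChange_def]
        constructor <;> ring
      · have hx : x₁ = x₂ := by
          have := mul_left_cancel₀ (pow_ne_zero 2 hv) H.1
          linear_combination this
        refine ⟨hx, ?_⟩
        have := H.2
        rw [negY_variableChange] at this
        have := mul_left_cancel₀ (pow_ne_zero 3 hv) this
        linear_combination this + C.s * hx

theorem changeHom_one_some [DecidableEq K] {E E' : WeierstrassCurve K}
    (h : (1 : VariableChange K) • E = E') {x y : K} (hxy : E.toAffine.Nonsingular x y)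
    (hxy' : E'.toAffine.Nonsingular x y) :
    changeHom 1 h (.some x y hxy) = .some x y hxy' := by
  simp [changeHom, changePoint, VariableChange.one_def]

/-- The curve `E^σ` is `E.map σ`; on points, `σ` is the map `(x, y) ↦ (σ x, σ y)`. -/
noncomputable def conjHom [DecidableEq K] {E E' : WeierstrassCurve K} (σ : K ≃+* K)
    (h : E.map (σ : K →+* K) = E') : E.toAffine.Point ≃+ E'.toAffine.Point where
  toFun
  | .zero => .zero
  | .some x y hxy => .some (σ x) (σ y)
      (h ▸ (Affine.map_nonsingular E (f := (σ : K →+* K)) σ.injective x y).mpr hxy)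
  invFun
  | .zero => .zero
  | .some x y hxy => .some (σ.symm x) (σ.symm y) (by
      subst h
      rw [← Affine.map_nonsingular E (f := (σ : K →+* K)) σ.injective]
      simpa using hxy)
  left_inv P := by cases P <;> simp
  right_inv P := by cases P <;> simp
  map_add' := by
    subst h
    have hY : ∀ x y, (E.map (σ : K →+* K)).toAffine.negY (σ x) (σ y) = σ (E.toAffine.negY x y) :=
      Affine.map_negY (W' := E) (f := (σ : K →+* K))
    rintro (_ | ⟨x₁, y₁, h₁⟩) (_ | ⟨x₂, y₂, h₂⟩)
    any_goals rfl
    by_cases hxy : x₁ = x₂ ∧ y₁ = E.toAffine.negY x₂ y₂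
    · rw [Affine.Point.add_of_Y_eq hxy.left hxy.right]
      refine (Affine.Point.add_of_Y_eq (by rw [hxy.1]) ?_).symm
      rw [hY, hxy.2]
    · rw [Affine.Point.add_some hxy]
      refine .trans ?_ (Affine.Point.add_some fun H => hxy ?_).symm
      · have hs : (E.map (σ : K →+* K)).toAffine.slope (σ x₁) (σ x₂) (σ y₁) (σ y₂) =
            σ (E.toAffine.slope x₁ x₂ y₁ y₂) := Affine.map_slope (W := E) (σ : K →+* K) ..
        simp only [Affine.Point.some.injEq]
        rw [hs]
        exact ⟨(Affine.map_addX (W' := E) (σ : K →+* K) ..).symm,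
          (Affine.map_addY (W' := E) (σ : K →+* K) ..).symm⟩
      · exact ⟨σ.injective H.1, σ.injective (by rw [← hY]; exact H.2)⟩

end Points

section Torsion

variable {A B D : Type*} [AddCommGroup A] [AddCommGroup B] [AddCommGroup D]

/-- The `p`-torsion subgroup of the group of points of `E`. -/
abbrev Torsion {K : Type*} [Field K] [DecidableEq K] (p : ℕ) (E : WeierstrassCurve K) :=
  AddSubgroup.torsionBy E.toAffine.Point (p : ℤ)

/-- `E[p]` is a vector space over `𝔽_p`. -/
noncomputable instance {K : Type*} [Field K] [DecidableEq K] (p : ℕ) (E : WeierstrassCurve K) :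
    Module (ZMod p) (Torsion p E) :=
  AddSubgroup.torsionBy.zmodModule

/-- The isomorphism `A[p] ≃ B[p]` induced by an isomorphism `A ≃ B`. -/
def torsionMap (p : ℕ) (f : A ≃+ B) :
    AddSubgroup.torsionBy A (p : ℤ) ≃+ AddSubgroup.torsionBy B (p : ℤ) where
  toFun x := ⟨f x, by
    rw [AddSubgroup.torsionBy.nsmul_iff, ← map_nsmul,
      AddSubgroup.torsionBy.nsmul_iff.mp x.2, map_zero]⟩
  invFun x := ⟨f.symm x, by
    rw [AddSubgroup.torsionBy.nsmul_iff, ← map_nsmul,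
      AddSubgroup.torsionBy.nsmul_iff.mp x.2, map_zero]⟩
  left_inv x := by simp
  right_inv x := by simp
  map_add' x y := by ext; simp

end Torsion

section Necklaces

variable {p : ℕ}

/-- An isomorphism of `𝔽_p`-vector spaces from an isomorphism of the underlying groups. -/
def toLin {p : ℕ} {V V' : Type*} [AddCommGroup V] [Module (ZMod p) V] [AddCommGroup V']
    [Module (ZMod p) V'] (e : V ≃+ V') : V ≃ₗ[ZMod p] V' where
  __ := e
  map_smul' c x := by simpa using ZMod.map_smul (e : V →+ V') c x

variable [Fact p.Prime]

/-- `g` represents an element of the conjugacy class `𝒞_γ` of `PGL(V)`: in some (equivalently,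
any) basis of the two-dimensional space `V`, the matrix of `g` has characteristic polynomial equal
to the minimal polynomial of `γ` over `𝔽_p`. -/
def InClass (γ : GaloisField p 2) {V : Type*} [AddCommGroup V] [Module (ZMod p) V]
    (g : V ≃ₗ[ZMod p] V) : Prop :=
  ∃ b : Module.Basis (Fin 2) (ZMod p) V,
    (LinearMap.toMatrix b b (g : V →ₗ[ZMod p] V)).charpoly = minpoly (ZMod p) γ

/-- A list `(C_0, …, C_p)` of all the cyclic subgroups of order `p` of `V`, each occurring once,
such that some `h ∈ 𝒞_γ` satisfies `h (C_i) = C_{i+1}`. Indices are taken modulo `p + 1`; as `h`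
permutes these subgroups, the condition for `i = p` follows from those for `i = 0, …, p - 1`. -/
@[ext]
structure NecklaceList (γ : GaloisField p 2) (V : Type*) [AddCommGroup V]
    [Module (ZMod p) V] where
  pearl : ZMod (p + 1) → AddSubgroup V
  injective : Function.Injective pearl
  mem_range : ∀ L : AddSubgroup V, L ∈ Set.range pearl ↔ IsAddCyclic L ∧ Nat.card L = p
  exists_turn : ∃ h : V ≃ₗ[ZMod p] V, InClass γ h ∧
    ∀ i, (pearl i).map (h : V →+ V) = pearl (i + 1)

variable {γ : GaloisField p 2} {V V' V'' : Type*} [AddCommGroup V] [Module (ZMod p) V]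
  [AddCommGroup V'] [Module (ZMod p) V'] [AddCommGroup V''] [Module (ZMod p) V'']

/-- Two lists are equivalent if they differ by a cyclic permutation. -/
instance NecklaceList.setoid (γ : GaloisField p 2) (V : Type*) [AddCommGroup V]
    [Module (ZMod p) V] : Setoid (NecklaceList γ V) where
  r C C' := ∃ r, ∀ i, C'.pearl i = C.pearl (i + r)
  iseqv := ⟨fun C => ⟨0, by simp⟩,
    fun {C C'} ⟨r, h⟩ => ⟨-r, fun i => by simp [h]⟩,
    fun {C C' C''} ⟨r, h⟩ ⟨r', h'⟩ => ⟨r' + r, fun i => by simp [h, h', add_assoc]⟩⟩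

/-- The list `(e (C_0), …, e (C_p))`. -/
def NecklaceList.map (e : V ≃+ V') (C : NecklaceList γ V) : NecklaceList γ V' where
  pearl i := (C.pearl i).map (e : V →+ V')
  injective := (AddSubgroup.map_injective e.injective).comp C.injective
  mem_range L := by
    have hc : ∀ M : AddSubgroup V, IsAddCyclic (M.map (e : V →+ V')) ↔ IsAddCyclic M := fun M =>
      (e.addSubgroupMap M).isAddCyclic.symm
    have hn : ∀ M : AddSubgroup V, Nat.card (M.map (e : V →+ V')) = Nat.card M := fun M =>
      (Nat.card_congr (e.addSubgroupMap M).toEquiv).symm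
    constructor
    · rintro ⟨i, rfl⟩
      simpa only [hc, hn] using (C.mem_range _).mp ⟨i, rfl⟩
    · intro hL
      have hM : (L.comap (e : V →+ V')).map (e : V →+ V') = L :=
        AddSubgroup.map_comap_eq_self_of_surjective e.surjective L
      rw [← hM, hc, hn, ← C.mem_range] at hL
      obtain ⟨i, hi⟩ := hL
      exact ⟨i, by simp only [hi, hM]⟩
  exists_turn := by
    obtain ⟨h, ⟨b, hb⟩, hC⟩ := C.exists_turn
    refine ⟨(toLin e).symm.trans (h.trans (toLin e)), ⟨b.map (toLin e), ?_⟩, fun i => ?_⟩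
    · rw [← hb]
      congr 1
      ext i j
      simp [LinearMap.toMatrix_apply]
    · rw [← hC i, AddSubgroup.map_map, AddSubgroup.map_map]
      congr 1
      ext x
      simp [toLin]

/-- The reversed list `(C_p, C_{p-1}, …, C_0)`. -/
def NecklaceList.reverse (C : NecklaceList γ V) : NecklaceList γ V where
  pearl i := C.pearl (p - i)
  injective i j h := by simpa using C.injective h
  mem_range L := by
    rw [← C.mem_range L]
    exact ⟨fun ⟨i, h⟩ => ⟨_, h⟩, fun ⟨i, h⟩ => ⟨p - i, by simpa using h⟩⟩
  exists_turn := by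
    obtain ⟨h, ⟨b, hb⟩, hC⟩ := C.exists_turn
    -- if `A` is the matrix of `h`, use the map with matrix `det A • A⁻¹`, the adjugate of `A`
    set A := LinearMap.toMatrix b b (h : V →ₗ[ZMod p] V) with hA
    set A' := LinearMap.toMatrix b b (h.symm : V →ₗ[ZMod p] V) with hA'
    have hAA : A * A' = 1 := by
      rw [hA, hA', ← LinearMap.toMatrix_comp, LinearEquiv.comp_symm, LinearMap.toMatrix_id]
    have hdet : A.det ≠ 0 := fun h0 => by
      have := congrArg Matrix.det hAA
      simp [h0] at this
    refine ⟨h.symm.trans (LinearEquiv.smulOfNeZero (ZMod p) V A.det hdet), ⟨b, ?_⟩, fun i => ?_⟩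
    · have hm : LinearMap.toMatrix b b
          ((h.symm.trans (LinearEquiv.smulOfNeZero (ZMod p) V A.det hdet) : V ≃ₗ[ZMod p] V) :
            V →ₗ[ZMod p] V) = A.adjugate := by
        have : ((h.symm.trans (LinearEquiv.smulOfNeZero (ZMod p) V A.det hdet) :
            V ≃ₗ[ZMod p] V) : V →ₗ[ZMod p] V) = A.det • (h.symm : V →ₗ[ZMod p] V) := by
          ext x
          simp
        rw [this, map_smul, ← hA']
        calc A.det • A' = (A.adjugate * A) * A' := by simp [Matrix.adjugate_mul]
          _ = A.adjugate := by rw [mul_assoc, hAA, mul_one]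
      rw [hm, ← hb, Matrix.charpoly_fin_two, Matrix.charpoly_fin_two, Matrix.det_adjugate,
        Matrix.adjugate_fin_two]
      simp [Matrix.trace_fin_two, add_comm]
    · have hi : C.pearl (p - i) = (C.pearl (p - (i + 1))).map (h : V →+ V) := by
        rw [hC]
        congr 1
        ring
      rw [hi]
      ext x
      simp only [AddSubgroup.mem_map, exists_exists_and_eq_and]
      constructor
      · rintro ⟨y, hy, rfl⟩
        simpa using ZMod.smul_mem hy A.det
      · intro hx
        exact ⟨A.det⁻¹ • x, ZMod.smul_mem hx _, by simp [hdet]⟩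

/-- An oriented necklace in `V`: a class of lists up to cyclic permutation. -/
def OrientedNecklace (γ : GaloisField p 2) (V : Type*) [AddCommGroup V] [Module (ZMod p) V] :=
  Quotient (NecklaceList.setoid γ V)

/-- The action of isomorphisms on oriented necklaces. -/
def OrientedNecklace.map (e : V ≃+ V') : OrientedNecklace γ V → OrientedNecklace γ V' :=
  Quotient.map (NecklaceList.map e) fun C C' ⟨r, h⟩ => ⟨r, fun i => by
    simp [NecklaceList.map, h]⟩

/-- The involution `w` changing the orientation. -/
def OrientedNecklace.w : OrientedNecklace γ V → OrientedNecklace γ V :=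
  Quotient.map NecklaceList.reverse fun C C' ⟨r, h⟩ => ⟨-r, fun i => by
    simp only [NecklaceList.reverse, h]
    congr 1
    ring⟩

theorem OrientedNecklace.w_w (v : OrientedNecklace γ V) : v.w.w = v := by
  induction v using Quotient.inductionOn with
  | h C =>
    refine congrArg (Quotient.mk _) ?_
    ext i : 2
    simp [NecklaceList.reverse]

theorem OrientedNecklace.map_w (e : V ≃+ V') (v : OrientedNecklace γ V) :
    OrientedNecklace.map e v.w = (OrientedNecklace.map e v).w := by
  induction v using Quotient.inductionOn with
  | h C => rfl

theorem OrientedNecklace.map_refl (v : OrientedNecklace γ V) :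
    OrientedNecklace.map (AddEquiv.refl V) v = v := by
  induction v using Quotient.inductionOn with
  | h C =>
    refine congrArg (Quotient.mk _) ?_
    ext i x
    simp [NecklaceList.map]

theorem OrientedNecklace.map_map (e : V ≃+ V') (e' : V' ≃+ V'') (v : OrientedNecklace γ V) :
    OrientedNecklace.map e' (OrientedNecklace.map e v) = OrientedNecklace.map (e.trans e') v := by
  induction v using Quotient.inductionOn with
  | h C =>
    refine congrArg (Quotient.mk _) ?_
    ext i x
    simp [NecklaceList.map]

/-- The relation of being in the same orbit `{v, w v}` under `w`. -/
instance OrientedNecklace.setoid (γ : GaloisField p 2) (V : Type*) [AddCommGroup V]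
    [Module (ZMod p) V] : Setoid (OrientedNecklace γ V) where
  r v v' := v' = v ∨ v' = v.w
  iseqv := ⟨fun _ => .inl rfl,
    by rintro v v' (rfl | rfl) <;> simp [OrientedNecklace.w_w],
    by rintro v v' v'' (rfl | rfl) (rfl | rfl) <;> simp [OrientedNecklace.w_w]⟩

/-- A necklace in `V`: an orbit `{v, w v}` of oriented necklaces. -/
def UnorientedNecklace (γ : GaloisField p 2) (V : Type*) [AddCommGroup V] [Module (ZMod p) V] :=
  Quotient (OrientedNecklace.setoid γ V)

/-- The action of isomorphisms on necklaces. -/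
def UnorientedNecklace.map (e : V ≃+ V') : UnorientedNecklace γ V → UnorientedNecklace γ V' :=
  Quotient.map (OrientedNecklace.map e) (by
    rintro v v' (rfl | rfl)
    · exact .inl rfl
    · exact .inr (OrientedNecklace.map_w e v))

theorem UnorientedNecklace.map_refl (v : UnorientedNecklace γ V) :
    UnorientedNecklace.map (AddEquiv.refl V) v = v := by
  induction v using Quotient.inductionOn with
  | h v => exact congrArg (Quotient.mk _) (OrientedNecklace.map_refl v)

theorem UnorientedNecklace.map_map (e : V ≃+ V') (e' : V' ≃+ V'') (v : UnorientedNecklace γ V) :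
    UnorientedNecklace.map e' (UnorientedNecklace.map e v) =
      UnorientedNecklace.map (e.trans e') v := by
  induction v using Quotient.inductionOn with
  | h v => exact congrArg (Quotient.mk _) (OrientedNecklace.map_map e e' v)

end Necklaces

section Moduli

universe u

/-- A kind of structure on `𝔽_p`-vector spaces that can be transported along isomorphisms. -/
structure LevelStructure (p : ℕ) where
  obj : (V : Type u) → [AddCommGroup V] → [Module (ZMod p) V] → Type u
  map : {V V' : Type u} → [AddCommGroup V] → [Module (ZMod p) V] → [AddCommGroup V'] →
    [Module (ZMod p) V'] → (V ≃+ V') → obj V → obj V'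
  map_refl : ∀ {V : Type u} [AddCommGroup V] [Module (ZMod p) V] (v : obj V),
    map (AddEquiv.refl V) v = v
  map_map : ∀ {V V' V'' : Type u} [AddCommGroup V] [Module (ZMod p) V] [AddCommGroup V']
    [Module (ZMod p) V'] [AddCommGroup V''] [Module (ZMod p) V''] (e : V ≃+ V') (e' : V' ≃+ V'')
    (v : obj V), map e' (map e v) = map (e.trans e') v

/-- Oriented necklaces as a level structure. -/
def nsp {p : ℕ} [Fact p.Prime] (γ : GaloisField p 2) : LevelStructure.{u} p where
  obj V := OrientedNecklace γ V
  map e := OrientedNecklace.map e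
  map_refl := OrientedNecklace.map_refl
  map_map := OrientedNecklace.map_map

/-- Necklaces as a level structure. -/
def nspPlus {p : ℕ} [Fact p.Prime] (γ : GaloisField p 2) : LevelStructure.{u} p where
  obj V := UnorientedNecklace γ V
  map e := UnorientedNecklace.map e
  map_refl := UnorientedNecklace.map_refl
  map_map := UnorientedNecklace.map_map

variable {p : ℕ} (F : LevelStructure.{u} p) (K : Type u) [Field K] [DecidableEq K]

/-- A pair `(E, v)` of an elliptic curve `E` over `K` and a level structure `v` on `E[p]`. -/
structure Pair where
  curve : WeierstrassCurve K
  isElliptic : curve.IsElliptic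
  level : F.obj (Torsion p curve)

variable {F K}

theorem map_map_eq {E E₁ E₂ E' : WeierstrassCurve K} (f : E.toAffine.Point ≃+ E₁.toAffine.Point)
    (g : E₁.toAffine.Point ≃+ E'.toAffine.Point) (f' : E.toAffine.Point ≃+ E₂.toAffine.Point)
    (g' : E₂.toAffine.Point ≃+ E'.toAffine.Point) (h : ∀ P, g (f P) = g' (f' P))
    (v : F.obj (Torsion p E)) :
    F.map (torsionMap p g) (F.map (torsionMap p f) v) =
      F.map (torsionMap p g') (F.map (torsionMap p f') v) := by
  rw [F.map_map, F.map_map]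
  congr 1
  ext x
  exact h x

theorem map_map_eq' {E E₁ E' : WeierstrassCurve K} (f : E.toAffine.Point ≃+ E₁.toAffine.Point)
    (g : E₁.toAffine.Point ≃+ E'.toAffine.Point) (f' : E.toAffine.Point ≃+ E'.toAffine.Point)
    (h : ∀ P, g (f P) = f' P) (v : F.obj (Torsion p E)) :
    F.map (torsionMap p g) (F.map (torsionMap p f) v) = F.map (torsionMap p f') v := by
  rw [F.map_map]
  congr 1
  ext x
  exact h x

theorem map_self {E : WeierstrassCurve K} (f : E.toAffine.Point ≃+ E.toAffine.Point)
    (h : ∀ P, f P = P) (v : F.obj (Torsion p E)) : F.map (torsionMap p f) v = v := by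
  refine Eq.trans ?_ (F.map_refl v)
  congr 1
  ext x
  exact h x

/-- `(E, v)` and `(E', v')` are isomorphic over `K`: an isomorphism `E ≃ E'` maps `v` to `v'`. -/
def Pair.Iso (x y : Pair F K) : Prop :=
  ∃ (C : VariableChange K) (h : C • x.curve = y.curve),
    F.map (torsionMap p (changeHom C h)) x.level = y.level

instance Pair.setoid (F : LevelStructure.{u} p) (K : Type u) [Field K] [DecidableEq K] :
    Setoid (Pair F K) where
  r := Pair.Iso
  iseqv := by
    refine ⟨fun x => ⟨1, one_smul _ _,
      map_self _ (fun P => changePoint_one (one_smul _ _) rfl P) _⟩, ?_, ?_⟩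
    · rintro x y ⟨C, h, hv⟩
      refine ⟨C⁻¹, by rw [← h, inv_smul_smul], ?_⟩
      rw [← hv, F.map_map]
      refine Eq.trans ?_ (F.map_refl _)
      congr 1
      ext P
      exact (changeHom C h).symm_apply_apply P
    · rintro x y z ⟨C, h, hv⟩ ⟨C', h', hv'⟩
      refine ⟨C' * C, by rw [mul_smul, h, h'], ?_⟩
      rw [← hv', ← hv]
      exact (map_map_eq' _ _ _ (fun P => changePoint_changePoint C C' h h'
        (by rw [mul_smul, h, h']) P) _).symm

variable (F K) in
/-- The moduli space of `K`-isomorphism classes of pairs `(E, v)`. -/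
def ModuliSpace := Quotient (Pair.setoid F K)

/-- The point of the moduli space represented by `(E, v)`. -/
def ModuliSpace.mk (E : WeierstrassCurve K) [h : E.IsElliptic] (v : F.obj (Torsion p E)) :
    ModuliSpace F K :=
  Quotient.mk _ ⟨E, h, v⟩

/-- The pair `(E^σ, σ(v))`. -/
noncomputable def Pair.conj (σ : K ≃+* K) (x : Pair F K) : Pair F K where
  curve := x.curve.map (σ : K →+* K)
  isElliptic := have := x.isElliptic; inferInstance
  level := F.map (torsionMap p (conjHom σ rfl)) x.level

theorem conjHom_changeHom {E E' : WeierstrassCurve K} (C : VariableChange K) (h : C • E = E')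
    (σ : K ≃+* K)
    (h' : C.map (σ : K →+* K) • E.map (σ : K →+* K) = E'.map (σ : K →+* K))
    (P : E.toAffine.Point) :
    conjHom (E' := E'.map (σ : K →+* K)) σ rfl (changeHom C h P) =
      changeHom (C.map (σ : K →+* K)) h'
        (conjHom (E' := E.map (σ : K →+* K)) σ rfl P) := by
  cases P with
  | zero => rfl
  | some x y hxy => simp [changeHom, changePoint, conjHom]

variable {k : Type*} [Field k] [Algebra k K]

/-- The action `σ (E, v) = (E^σ, σ(v))` of the Galois group on isomorphism classes of pairs. -/
noncomputable instance : MulAction (K ≃ₐ[k] K) (ModuliSpace F K) where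
  smul σ := Quotient.map (Pair.conj (σ : K ≃+* K)) (by
    rintro x y ⟨C, h, hv⟩
    refine ⟨C.map ((σ : K ≃+* K) : K →+* K), by
      simp only [Pair.conj]; rw [map_variableChange, h], ?_⟩
    simp only [Pair.conj]
    rw [← hv]
    exact map_map_eq _ _ _ _ (fun P => (conjHom_changeHom C h _ _ P).symm) _)
  one_smul x := by
    induction x using Quotient.inductionOn with
    | h x =>
      refine Quotient.sound ⟨1, one_smul _ _, ?_⟩
      refine (map_map_eq' _ _ (AddEquiv.refl _) (fun P => ?_) _).trans (map_self _ (by simp) _)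
      cases P with
      | zero => rfl
      | some a b hab => exact changeHom_one_some _ _ hab
  mul_smul σ τ x := by
    induction x using Quotient.inductionOn with
    | h x =>
      refine Quotient.sound ⟨1, one_smul _ _, ?_⟩
      simp only [Pair.conj]
      refine map_map_eq _ _ _ _ (fun P => ?_) _
      cases P with
      | zero => rfl
      | some a b hab => exact changeHom_one_some _ _ _

end Moduli

section Representation

variable {p : ℕ} {k K : Type*} [Field k] [Field K] [DecidableEq K] [Algebra k K]

instance (E : WeierstrassCurve k) [E.IsElliptic] : (E.baseChange K).IsElliptic :=
  inferInstanceAs (E.map (algebraMap k K)).IsElliptic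

/-- The action of `σ` on the points over `K` of a curve `E` defined over `k`. -/
noncomputable def galoisPoint (E : WeierstrassCurve k) (σ : K ≃ₐ[k] K) :
    (E.baseChange K).toAffine.Point ≃+ (E.baseChange K).toAffine.Point where
  __ := Affine.Point.map (W' := E) (σ : K →ₐ[k] K)
  invFun := Affine.Point.map (W' := E) (σ.symm : K →ₐ[k] K)
  left_inv P := by
    cases P with
    | zero => rfl
    | some x y h => simp [Affine.Point.map]
  right_inv P := by
    cases P with
    | zero => rfl
    | some x y h => simp [Affine.Point.map]

/-- The Galois representation `Gal(K/k) → GL(E[p])` of a curve `E` over `k`. -/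
noncomputable def galoisRep (p : ℕ) (K : Type*) [Field K] [DecidableEq K] [Algebra k K]
    (E : WeierstrassCurve k) :
    (K ≃ₐ[k] K) →* (Torsion p (E.baseChange K) ≃ₗ[ZMod p] Torsion p (E.baseChange K)) where
  toFun σ := toLin (torsionMap p (galoisPoint E σ))
  map_one' := by
    ext ⟨P, hP⟩
    cases P <;> rfl
  map_mul' σ τ := by
    ext ⟨P, hP⟩
    cases P <;> rfl

/-- A non-split Cartan subgroup of `GL(V)`: for some `𝔽_p`-linear identification of `V` with
`𝔽_{p²}` (a choice of basis of `V` and of a basis of `𝔽_{p²}`), it consists of the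
multiplications by the elements of `𝔽_{p²}ˣ`. -/
def IsNonsplitCartan [Fact p.Prime] {V : Type*} [AddCommGroup V] [Module (ZMod p) V]
    (H : Subgroup (V ≃ₗ[ZMod p] V)) : Prop :=
  ∃ e : GaloisField p 2 ≃ₗ[ZMod p] V, ∀ g, g ∈ H ↔
    ∃ β : (GaloisField p 2)ˣ, ∀ z, g (e z) = e (β * z)

end Representation

end Necklace

namespace Necklace

open WeierstrassCurve

/-! ### Stabilisers of necklaces and non-split Cartan subgroups. -/

section CartanSubgroups

variable {p : ℕ} [Fact p.Prime] {V : Type*} [AddCommGroup V] [Module (ZMod p) V]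

/-! Descent of the curve: if the class of `(E, v)` is Galois-fixed, then `E^σ ≅ E` for every `σ`, so
`j(E)` lies in `k`. Over a separably closed field the `j`-invariant determines the curve up to
isomorphism, so `E` can be replaced by the base change of `ofJ j`, with `v` transported along.

Galois action: if `E` is defined over `k` then `E^σ = E`, and fixedness of the class gives an
automorphism of `E` over `K` carrying `σ(v)` to `v`. For `j ≠ 0, 1728` it is `±1`
(`eq_one_or_eq_neg_one_of_smul_eq`, in all characteristics), which preserves every subgroup and
hence every necklace. So `σ(v) = v`.

Image: the turn `h` of a necklace is multiplication by `γ` on `V ≅ 𝔽_{p²}`, so `⟨h⟩` is a full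
non-split Cartan subgroup. If `g` rotates the pearls by `r`, then `h⁻ʳ g` fixes every line, hence is
a scalar, and `g ∈ ⟨h⟩`. If `g` reverses the necklace, then `g h g⁻¹` rotates by `-1`, so it lies in
`⟨h⟩` and `g` normalises `⟨h⟩`. -/

theorem adjoin_eq_top_of_forall_mem_zpowers {k L : Type*} [Field k] [Field L] [Algebra k L]
    [Finite L] {γ : Lˣ} (hγ : ∀ x, x ∈ Subgroup.zpowers γ) :
    Algebra.adjoin k {(γ : L)} = ⊤ := by
  refine eq_top_iff.mpr fun x _ => ?_
  by_cases hx : x = 0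
  · rw [hx]
    exact zero_mem _
  · obtain ⟨n, hn⟩ := mem_powers_iff_mem_zpowers.mpr (hγ (Units.mk0 x hx))
    have hn' : (γ : L) ^ n = x := by simpa using congrArg Units.val hn
    rw [← hn']
    exact pow_mem (Algebra.subset_adjoin (Set.mem_singleton _)) n

/-- An element of `𝒞_γ` is multiplication by `γ` in a suitable identification of `V` with
`𝔽_{p²}`. -/
theorem InClass.exists_linearEquiv {γ : (GaloisField p 2)ˣ} (hγ : ∀ x, x ∈ Subgroup.zpowers γ)
    {h : V ≃ₗ[ZMod p] V} (hh : InClass (γ : GaloisField p 2) h) :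
    ∃ e : GaloisField p 2 ≃ₗ[ZMod p] V, ∀ z, h (e z) = e (γ * z) := by
  obtain ⟨b, hb⟩ := hh
  have : Module.Finite (ZMod p) V := .of_basis b
  have hV : Module.finrank (ZMod p) V = 2 := by simp [Module.finrank_eq_card_basis b]
  have hint : IsIntegral (ZMod p) (γ : GaloisField p 2) := .of_finite _ _
  let pb := PowerBasis.ofAdjoinEqTop hint (adjoin_eq_top_of_forall_mem_zpowers hγ)
  -- By Cayley–Hamilton `h` is a root of the minimal polynomial of `γ`, so `γ ↦ h` makes `V` a
  -- vector space over `𝔽_p[γ] = 𝔽_{p²}`. The orbit map of `b 0 ≠ 0` is injective because nonzero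
  -- scalars are invertible, and bijective because both sides have dimension 2.
  have hroot : Polynomial.aeval (h : Module.End (ZMod p) V) (minpoly (ZMod p) pb.gen) = 0 := by
    rw [PowerBasis.ofAdjoinEqTop_gen, ← hb, LinearMap.charpoly_toMatrix]
    exact LinearMap.aeval_self_charpoly _
  let φ := pb.lift (h : Module.End (ZMod p) V) hroot
  have hφ : φ γ = (h : Module.End (ZMod p) V) := pb.lift_gen _ hroot
  have hinj : Function.Injective (φ.toLinearMap.flip (b 0)) := by
    rw [injective_iff_map_eq_zero]
    intro z hz
    by_contra hz0
    have h1 : φ z⁻¹ (φ z (b 0)) = b 0 := by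
      rw [← Module.End.mul_apply, ← map_mul, inv_mul_cancel₀ hz0, map_one, Module.End.one_apply]
    have h2 : φ z (b 0) = 0 := hz
    rw [h2, map_zero] at h1
    exact b.ne_zero 0 h1.symm
  refine ⟨LinearMap.linearEquivOfInjective _ hinj
    (by rw [GaloisField.finrank p two_ne_zero, hV]), fun z => ?_⟩
  change h (φ z (b 0)) = φ (γ * z) (b 0)
  rw [map_mul, hφ]
  rfl

/-- Since `γ` generates the unit group, the powers of multiplication by `γ` exhaust the
multiplications by units. -/
theorem isNonsplitCartan_zpowers {γ : (GaloisField p 2)ˣ} (hγ : ∀ x, x ∈ Subgroup.zpowers γ)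
    {h : V ≃ₗ[ZMod p] V} (hh : InClass (γ : GaloisField p 2) h) :
    IsNonsplitCartan (Subgroup.zpowers h) := by
  obtain ⟨e, he⟩ := hh.exists_linearEquiv hγ
  have hpow : ∀ (n : ℕ) z, (h ^ n) (e z) = e ((γ ^ n : (GaloisField p 2)ˣ) * z) := by
    intro n
    induction n with
    | zero => simp
    | succ n ih =>
      intro z
      rw [pow_succ', LinearEquiv.mul_apply, ih, he, pow_succ']
      simp [mul_assoc]
  have hzpow : ∀ (n : ℤ) z, (h ^ n) (e z) = e ((γ ^ n : (GaloisField p 2)ˣ) * z) := by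
    rintro (n | n) z
    · simpa using hpow n z
    · rw [zpow_negSucc, zpow_negSucc]
      refine (h ^ (n + 1)).injective ?_
      rw [hpow, ← LinearEquiv.mul_apply, mul_inv_cancel, ← mul_assoc, Units.mul_inv, one_mul]
      rfl
  refine ⟨e, fun g => ⟨?_, ?_⟩⟩
  · rintro ⟨n, rfl⟩
    exact ⟨γ ^ n, hzpow n⟩
  · rintro ⟨β, hβ⟩
    obtain ⟨n, rfl⟩ := hγ β
    refine ⟨n, LinearEquiv.ext fun x => ?_⟩
    obtain ⟨z, rfl⟩ := e.surjective x
    exact (hzpow n z).trans (hβ z).symm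

/-- Scalars come from `𝔽_pˣ ⊆ 𝔽_{p²}ˣ`; that `a ≠ 0` follows from injectivity of `g`. -/
theorem IsNonsplitCartan.mem_of_forall_apply_eq_smul {H : Subgroup (V ≃ₗ[ZMod p] V)}
    (hH : IsNonsplitCartan H) {g : V ≃ₗ[ZMod p] V} {a : ZMod p} (hg : ∀ x, g x = a • x) :
    g ∈ H := by
  obtain ⟨e, he⟩ := hH
  have ha : algebraMap (ZMod p) (GaloisField p 2) a ≠ 0 := by
    rw [Ne, FaithfulSMul.algebraMap_eq_zero_iff]
    rintro rfl
    have h1 : g (e 1) = 0 := by rw [hg, zero_smul]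
    rw [map_eq_zero_iff g g.injective, map_eq_zero_iff e e.injective] at h1
    exact one_ne_zero h1
  refine (he g).mpr ⟨Units.mk0 _ ha, fun z => ?_⟩
  rw [hg, Units.val_mk0, ← Algebra.smul_def, map_smul]

namespace NecklaceList

variable {γ : GaloisField p 2} (C : NecklaceList γ V)

theorem exists_pearl_eq_zmultiples {x : V} (hx : x ≠ 0) :
    ∃ i, C.pearl i = AddSubgroup.zmultiples x := by
  refine (C.mem_range _).mpr ⟨inferInstance, ?_⟩
  rw [Nat.card_zmultiples]
  refine addOrderOf_eq_prime ?_ hx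
  rw [← Nat.cast_smul_eq_nsmul (ZMod p), CharP.cast_eq_zero, zero_smul]

/-- `PGL(V)` acts faithfully on the lines of `V`. -/
theorem exists_apply_eq_smul {g : V ≃ₗ[ZMod p] V} (hg : ∀ i x, g x ∈ C.pearl i ↔ x ∈ C.pearl i) :
    ∃ a : ZMod p, ∀ x, g x = a • x := by
  -- An endomorphism under which every vector is an eigenvector is a scalar, and every nonzero
  -- vector spans a pearl, which `g` preserves.
  suffices h : ∀ v, ¬ LinearIndependent (ZMod p) ![v, (g : V →ₗ[ZMod p] V) v] by
    obtain ⟨a, ha⟩ := LinearMap.exists_eq_smul_id_of_forall_notLinearIndependent h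
    exact ⟨a, fun x => by simpa using LinearMap.congr_fun ha x⟩
  intro x hx
  have hx0 : x ≠ 0 := hx.ne_zero 0
  obtain ⟨i, hi⟩ := C.exists_pearl_eq_zmultiples hx0
  have hgx : g x ∈ C.pearl i := (hg i x).mpr (hi ▸ AddSubgroup.mem_zmultiples x)
  rw [hi, AddSubgroup.mem_zmultiples_iff] at hgx
  obtain ⟨n, hn⟩ := hgx
  refine (LinearIndependent.pair_iff' hx0).mp hx (n : ZMod p) ?_
  rw [Int.cast_smul_eq_zsmul]
  exact hn

theorem exists_turn_mem_iff (C : NecklaceList γ V) : ∃ h : V ≃ₗ[ZMod p] V, InClass γ h ∧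
    ∀ i x, h x ∈ C.pearl (i + 1) ↔ x ∈ C.pearl i := by
  obtain ⟨h, hh, hC⟩ := C.exists_turn
  refine ⟨h, hh, fun i x => ?_⟩
  rw [← hC, AddSubgroup.mem_map]
  exact ⟨fun ⟨y, hy, hyx⟩ => h.injective hyx ▸ hy, fun hx => ⟨x, hx, rfl⟩⟩

variable {C} in
theorem pow_apply_mem_pearl {h : V ≃ₗ[ZMod p] V}
    (hC : ∀ i x, h x ∈ C.pearl (i + 1) ↔ x ∈ C.pearl i) (n : ℕ) (i : ZMod (p + 1)) (x : V) :
    (h ^ n) x ∈ C.pearl (i + n) ↔ x ∈ C.pearl i := by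
  induction n with
  | zero => simp
  | succ n ih => rw [pow_succ', LinearEquiv.mul_apply, Nat.cast_succ, ← add_assoc, hC, ih]

variable {C}

/-- Undoing the rotation by `h ^ r.val` leaves a map that fixes every pearl, so a scalar, and
scalars already lie in the Cartan subgroup. -/
theorem mem_zpowers {h : V ≃ₗ[ZMod p] V} (hh : IsNonsplitCartan (Subgroup.zpowers h))
    (hC : ∀ i x, h x ∈ C.pearl (i + 1) ↔ x ∈ C.pearl i) {g : V ≃ₗ[ZMod p] V} (r : ZMod (p + 1))
    (hg : ∀ i x, g x ∈ C.pearl (i + r) ↔ x ∈ C.pearl i) : g ∈ Subgroup.zpowers h := by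
  obtain ⟨a, ha⟩ := C.exists_apply_eq_smul (g := (h ^ r.val)⁻¹ * g) fun i x => by
    rw [← hg i x, ← pow_apply_mem_pearl hC r.val, ← LinearEquiv.mul_apply, mul_inv_cancel_left,
      ZMod.natCast_zmod_val]
  simpa using mul_mem (pow_mem (Subgroup.mem_zpowers h) r.val) (hh.mem_of_forall_apply_eq_smul ha)

/-- As in a dihedral group, conjugating the rotation `i ↦ i + 1` by the reflection `i ↦ r - i` gives
`i ↦ i - 1`, and `mem_zpowers` applies to the conjugate. -/
theorem mem_normalizer_zpowers {h : V ≃ₗ[ZMod p] V} (hh : IsNonsplitCartan (Subgroup.zpowers h))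
    (hC : ∀ i x, h x ∈ C.pearl (i + 1) ↔ x ∈ C.pearl i) {g : V ≃ₗ[ZMod p] V} (r : ZMod (p + 1))
    (hg : ∀ i x, g x ∈ C.pearl i ↔ x ∈ C.pearl (r - i)) :
    g ∈ Subgroup.normalizer (Subgroup.zpowers h : Set (V ≃ₗ[ZMod p] V)) := by
  have key : ∀ f : V ≃ₗ[ZMod p] V, (∀ i x, f x ∈ C.pearl i ↔ x ∈ C.pearl (r - i)) →
      ∀ m ∈ Subgroup.zpowers h, f * m * f⁻¹ ∈ Subgroup.zpowers h := by
    intro f hf m hm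
    have hfh : f * h * f⁻¹ ∈ Subgroup.zpowers h := by
      refine mem_zpowers hh hC (-1) fun i x => ?_
      obtain ⟨y, rfl⟩ := f.surjective x
      have hy : (f * h * f⁻¹) (f y) = f (h y) := by
        rw [← LinearEquiv.mul_apply, inv_mul_cancel_right, LinearEquiv.mul_apply]
      rw [hy, hf, hf, ← hC (r - i)]
      ring_nf
    obtain ⟨n, rfl⟩ := hm
    simpa only [conj_zpow] using zpow_mem hfh n
  -- A reflection of the indices is its own inverse, so `key` also applies to `g⁻¹`, which gives the
  -- converse inclusion.
  have hinv : ∀ i x, g⁻¹ x ∈ C.pearl i ↔ x ∈ C.pearl (r - i) := fun i x => by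
    obtain ⟨y, rfl⟩ := g.surjective x
    rw [hg, ← LinearEquiv.mul_apply, inv_mul_cancel, sub_sub_cancel]
    rfl
  refine Subgroup.mem_normalizer_iff.mpr fun m => ⟨key g hg m, fun hm => ?_⟩
  simpa [mul_assoc] using key g⁻¹ hinv _ hm

theorem apply_mem_map_pearl (C : NecklaceList γ V) (g : V ≃ₗ[ZMod p] V) (i : ZMod (p + 1))
    (x : V) : g x ∈ (C.map g.toAddEquiv).pearl i ↔ x ∈ C.pearl i :=
  ⟨fun ⟨_, hy, hyx⟩ => g.injective hyx ▸ hy, fun hx => ⟨x, hx, rfl⟩⟩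

end NecklaceList

variable {γ : (GaloisField p 2)ˣ}

/-- One `H` must serve both cases: elements fixing an unoriented necklace may preserve or reverse
the orientation. -/
theorem OrientedNecklace.exists_isNonsplitCartan (hγ : ∀ x, x ∈ Subgroup.zpowers γ)
    (v : OrientedNecklace (γ : GaloisField p 2) V) :
    ∃ H : Subgroup (V ≃ₗ[ZMod p] V), IsNonsplitCartan H ∧
      (∀ g : V ≃ₗ[ZMod p] V, OrientedNecklace.map g.toAddEquiv v = v → g ∈ H) ∧
      ∀ g : V ≃ₗ[ZMod p] V, OrientedNecklace.map g.toAddEquiv v = v.w →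
        g ∈ Subgroup.normalizer (H : Set (V ≃ₗ[ZMod p] V)) := by
  induction v using Quotient.inductionOn with
  | h C =>
    obtain ⟨h, hh, hC⟩ := C.exists_turn_mem_iff
    have hH := isNonsplitCartan_zpowers hγ hh
    refine ⟨_, hH, fun g hg => ?_, fun g hg => ?_⟩
    · obtain ⟨r, hr⟩ := Quotient.exact hg
      -- `hr` reads `C_i = g(C_{i+r})`, so `g` rotates by `-r`.
      refine NecklaceList.mem_zpowers hH hC (-r) fun i x => ?_
      rw [hr, neg_add_cancel_right, NecklaceList.apply_mem_map_pearl]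
    · obtain ⟨r, hr⟩ := Quotient.exact hg
      -- Here `hr` reads `C_{p-i} = g(C_{i+r})`; replacing `i` by `p - i` gives `C_i =
      -- g(C_{p+r-i})`.
      refine NecklaceList.mem_normalizer_zpowers hH hC (p + r) fun i x => ?_
      have := hr (p - i)
      simp only [NecklaceList.reverse, sub_sub_cancel] at this
      rw [this, NecklaceList.apply_mem_map_pearl, sub_add_eq_add_sub]

theorem UnorientedNecklace.exists_isNonsplitCartan (hγ : ∀ x, x ∈ Subgroup.zpowers γ)
    (v : UnorientedNecklace (γ : GaloisField p 2) V) :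
    ∃ H : Subgroup (V ≃ₗ[ZMod p] V), IsNonsplitCartan H ∧
      ∀ g : V ≃ₗ[ZMod p] V, UnorientedNecklace.map g.toAddEquiv v = v →
        g ∈ Subgroup.normalizer (H : Set (V ≃ₗ[ZMod p] V)) := by
  induction v using Quotient.inductionOn with
  | h v =>
    obtain ⟨H, hH, h₁, h₂⟩ := v.exists_isNonsplitCartan hγ
    refine ⟨H, hH, fun g hg => ?_⟩
    obtain hg | hg := Quotient.exact hg
    · exact Subgroup.le_normalizer (h₁ g hg.symm)
    -- `hg` reads `v = w(g v)`; applying the involution `w` gives `g v = w v`.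
    · exact h₂ g (by conv_rhs => rw [hg, OrientedNecklace.w_w])

theorem OrientedNecklace.map_eq_self {e : V ≃+ V} (he : (∀ x, e x = x) ∨ ∀ x, e x = -x)
    {γ : GaloisField p 2} (v : OrientedNecklace γ V) : OrientedNecklace.map e v = v := by
  induction v using Quotient.inductionOn with
  | h C =>
    refine congrArg (Quotient.mk _) ?_
    ext i x
    obtain he | he := he <;> simp [NecklaceList.map, he, neg_eq_iff_eq_neg]

theorem UnorientedNecklace.map_eq_self {e : V ≃+ V} (he : (∀ x, e x = x) ∨ ∀ x, e x = -x)
    {γ : GaloisField p 2} (v : UnorientedNecklace γ V) : UnorientedNecklace.map e v = v := by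
  induction v using Quotient.inductionOn with
  | h v => exact congrArg (Quotient.mk _) (OrientedNecklace.map_eq_self he v)

end CartanSubgroups

/-! ### Automorphisms of elliptic curves with `j ≠ 0, 1728`. -/

section Automorphisms

variable {K : Type*} [Field K]

/-- Immediate from `1728 Δ = c₄³ - c₆²` and `j = c₄³ / Δ`. -/
theorem c₆_ne_zero_of_j_ne (E : WeierstrassCurve K) [E.IsElliptic] (h : E.j ≠ 1728) :
    E.c₆ ≠ 0 := by
  intro h6
  apply h
  rw [j, Units.inv_mul_eq_iff_eq_mul, coe_Δ']
  linear_combination E.c_relation.symm + E.c₆ * h6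

/-- If `j ≠ 0, 1728`, the only automorphisms of `E` are `±1`. -/
theorem eq_one_or_eq_neg_one_of_smul_eq (E : WeierstrassCurve K) [E.IsElliptic] (h0 : E.j ≠ 0)
    (h1728 : E.j ≠ 1728) {C : VariableChange K} (hC : C • E = E) :
    C = 1 ∨ C = ⟨-1, 0, -E.a₁, -E.a₃⟩ := by
  have h4 : E.c₄ ≠ 0 := fun h => h0 (E.j_eq_zero h)
  have h6 : E.c₆ ≠ 0 := c₆_ne_zero_of_j_ne E h1728
  -- Invariance of `c₄ ≠ 0` and `c₆ ≠ 0` gives `u⁻⁴ = u⁻⁶ = 1`.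
  have hu : ((C.u⁻¹ : Kˣ) : K) ^ 2 = 1 := by
    have e4 := congrArg WeierstrassCurve.c₄ hC
    have e6 := congrArg WeierstrassCurve.c₆ hC
    rw [variableChange_c₄] at e4
    rw [variableChange_c₆] at e6
    have e4' := mul_right_cancel₀ h4 (e4.trans (one_mul _).symm)
    have e6' := mul_right_cancel₀ h6 (e6.trans (one_mul _).symm)
    linear_combination e6' - ((C.u⁻¹ : Kˣ) : K) ^ 2 * e4'
  have e1 := congrArg WeierstrassCurve.a₁ hC
  have e2 := congrArg WeierstrassCurve.a₂ hC
  have e3 := congrArg WeierstrassCurve.a₃ hC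
  have e4 := congrArg WeierstrassCurve.a₄ hC
  have f2 := congrArg WeierstrassCurve.b₂ hC
  have f4 := congrArg WeierstrassCurve.b₄ hC
  rw [variableChange_a₁] at e1
  rw [variableChange_a₂] at e2
  rw [variableChange_a₃] at e3
  rw [variableChange_a₄] at e4
  rw [variableChange_b₂] at f2
  rw [variableChange_b₄] at f4
  have hu' : C.u = 1 ∨ C.u = -1 := by
    have h := mul_self_eq_one_iff.mp ((pow_two _).symm.trans hu)
    rw [← inv_inj, ← inv_inj (b := (-1 : Kˣ)), inv_one, inv_neg, inv_one]
    exact h.imp (fun h => Units.ext h) fun h => Units.ext (by simpa using h)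
  -- Invariance of `b₂` gives `12 r = 0`. If `r ≠ 0`, the characteristic is 2 or 3. Then `a₃` forces
  -- `a₁ = 0`, respectively `b₄` forces `b₂ = 0`; but `c₄` reduces to `a₁⁴`, respectively `b₂²`,
  -- contradicting `c₄ ≠ 0`.
  have hr : C.r = 0 := by
    have hv4 : ((C.u⁻¹ : Kˣ) : K) ^ 4 = 1 := by linear_combination (((C.u⁻¹ : Kˣ) : K) ^ 2 + 1) * hu
    rw [hu, one_mul, add_eq_left] at f2
    rw [hv4, one_mul, add_assoc, add_eq_left] at f4
    by_contra hr
    have h12 : (12 : K) = 0 := (mul_eq_zero.mp f2).resolve_right hr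
    have h23 : (2 : K) = 0 ∨ (3 : K) = 0 := by
      have : (2 : K) * (2 * 3) = 0 := by linear_combination h12
      simpa using this
    obtain h2 | h3 := h23
    · have hv : ((C.u⁻¹ : Kˣ) : K) = 1 := by
        obtain h | h := hu' <;> rw [h]
        · simp
        · simp only [inv_neg, inv_one, Units.val_neg, Units.val_one]
          linear_combination -h2
      have h1 : E.a₁ = 0 := by
        refine (mul_eq_zero.mp ?_).resolve_left hr
        rw [hv] at e3
        linear_combination e3 - C.t * h2
      apply h4
      simp only [c₄, b₂, b₄, h1]
      linear_combination (8 * E.a₂ ^ 2 - 12 * (2 * E.a₄)) * h2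
    · have hb : E.b₂ = 0 := by
        refine (mul_eq_zero.mp ?_).resolve_left hr
        linear_combination f4 - 2 * C.r ^ 2 * h3
      apply h4
      rw [c₄, hb]
      linear_combination -8 * E.b₄ * h3
  obtain ⟨u, r, s, t⟩ := C
  simp only [VariableChange.one_def, VariableChange.mk.injEq] at hr hu' e1 e2 e3 e4 ⊢
  subst hr
  -- Away from characteristic 2, the equations for `a₁` and `a₃` determine `s` and `t` from `u =
  -- ±1`. In characteristic 2 they say nothing and `u = 1` for both automorphisms; the `a₂` equation
  -- becomes `s(s + a₁) = 0`, and the `a₄` equation then determines `t` because `a₁ ≠ 0`.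
  by_cases h2 : (2 : K) = 0
  · have hu1 : (1 : Kˣ) = -1 := Units.ext (by simp; linear_combination h2)
    obtain rfl : u = 1 := hu'.elim id fun h => h.trans hu1.symm
    simp only [inv_one, Units.val_one] at e2 e4
    have ha₁ : E.a₁ ≠ 0 := fun h1 => h4 <| by
      simp only [c₄, b₂, b₄, h1]
      linear_combination (8 * E.a₂ ^ 2 - 12 * (2 * E.a₄)) * h2
    have hs : s = 0 ∨ s = -E.a₁ := by
      have : s * (s + E.a₁) = 0 := by linear_combination -e2
      exact (mul_eq_zero.mp this).imp_right eq_neg_of_add_eq_zero_left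
    have ht : s * E.a₃ + t * E.a₁ = 0 := by linear_combination -e4 - s * t * h2
    obtain rfl | rfl := hs
    · exact .inl ⟨rfl, rfl, rfl, by simpa [ha₁] using ht⟩
    · refine .inr ⟨hu1, rfl, rfl, ?_⟩
      have : E.a₁ * (t - E.a₃) = 0 := by linear_combination ht
      have := (mul_eq_zero.mp this).resolve_left ha₁
      linear_combination this + E.a₃ * h2
  · obtain rfl | rfl := hu'
    · refine .inl ⟨rfl, rfl, mul_left_cancel₀ h2 ?_, mul_left_cancel₀ h2 ?_⟩
      · simp only [inv_one, Units.val_one] at e1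
        linear_combination e1
      · simp only [inv_one, Units.val_one] at e3
        linear_combination e3
    · refine .inr ⟨rfl, rfl, mul_left_cancel₀ h2 ?_, mul_left_cancel₀ h2 ?_⟩
      · simp only [inv_neg, inv_one, Units.val_neg, Units.val_one] at e1
        linear_combination -e1
      · simp only [inv_neg, inv_one, Units.val_neg, Units.val_one] at e3
        linear_combination -e3

theorem changeHom_eq_or_eq_neg [DecidableEq K] {E : WeierstrassCurve K} [E.IsElliptic]
    (h0 : E.j ≠ 0) (h1728 : E.j ≠ 1728) (C : VariableChange K) (hC : C • E = E) :
    (∀ P, changeHom C hC P = P) ∨ ∀ P, changeHom C hC P = -P := by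
  obtain rfl | rfl := eq_one_or_eq_neg_one_of_smul_eq E h0 h1728 hC
  · exact .inl fun P => changePoint_one hC rfl P
  · refine .inr fun P => ?_
    cases P with
    | zero => rfl
    | some x y hxy =>
      simp only [changeHom, changePoint, Affine.Point.neg_some, AddEquiv.coe_mk, Equiv.coe_fn_mk,
        Affine.Point.some.injEq, Affine.negY, inv_neg, inv_one, Units.val_neg, Units.val_one]
      constructor <;> ring

theorem torsionMap_changeHom_eq_or_eq_neg [DecidableEq K] {p : ℕ} {k : Type*} [Field k]
    [Algebra k K] {E : WeierstrassCurve k} [E.IsElliptic] (h0 : E.j ≠ 0) (h1728 : E.j ≠ 1728)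
    (C : VariableChange K) (hC : C • E.baseChange K = E.baseChange K) :
    (∀ P, torsionMap p (changeHom C hC) P = P) ∨ ∀ P, torsionMap p (changeHom C hC) P = -P := by
  have hj : (E.baseChange K).j = algebraMap k K E.j := E.map_j (algebraMap k K)
  refine (changeHom_eq_or_eq_neg ?_ ?_ C hC).imp (fun h P => Subtype.ext (h P))
    fun h P => Subtype.ext (h P)
  · rwa [hj, Ne, FaithfulSMul.algebraMap_eq_zero_iff]
  · rw [hj, ← map_ofNat (algebraMap k K) 1728]
    exact fun h => h1728 ((algebraMap k K).injective h)

end Automorphisms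

/-! ### Galois-fixed points of the moduli space, for an arbitrary level structure. -/

section Descent

universe u

variable {p : ℕ} {F : LevelStructure.{u} p} {K : Type u} [Field K] [DecidableEq K]
  {k : Type*} [Field k] [Algebra k K]

theorem ModuliSpace.exists_mk_baseChange_eq [IsSepClosure k K]
    {x : ModuliSpace F K} (hx : x ∈ MulAction.fixedPoints (K ≃ₐ[k] K) (ModuliSpace F K)) :
    ∃ (E : WeierstrassCurve k) (_ : E.IsElliptic) (v : F.obj (Torsion p (E.baseChange K))),
      ModuliSpace.mk (E.baseChange K) v = x := by
  classical
  induction x using Quotient.inductionOn with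
  | h x =>
    obtain ⟨E, hE, v⟩ := x
    have hj : ∀ σ : K ≃ₐ[k] K, σ E.j = E.j := fun σ => by
      obtain ⟨C, hC, -⟩ := Quotient.exact (hx σ)
      have hC' : C • E.map ((σ : K ≃+* K) : K →+* K) = E := hC
      refine (E.map_j ((σ : K ≃+* K) : K →+* K)).symm.trans ?_
      rw [← variableChange_j _ C]
      congr 1
    -- A separable closure is Galois over `k`, so its fixed field is `k`.
    obtain ⟨j, hj⟩ := (InfiniteGalois.mem_range_algebraMap_iff_fixed E.j).mpr hj
    have : IsSepClosed K := IsSepClosure.sep_closed k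
    have hj' : E.j = ((ofJ j).baseChange K).j := by
      rw [← hj]
      nth_rw 1 [← ofJ_j j]
      exact ((ofJ j).map_j (algebraMap k K)).symm
    obtain ⟨C, hC⟩ := exists_variableChange_of_j_eq E ((ofJ j).baseChange K) hj'
    exact ⟨ofJ j, inferInstance, F.map (torsionMap p (changeHom C hC)) v,
      (Quotient.sound ⟨C, hC, rfl⟩ : (⟦_⟧ : ModuliSpace F K) = ⟦_⟧).symm⟩

/-- Since `E` has coefficients in `k`, `E^σ = E`, so the isomorphism `E^σ ≅ E` given by fixedness is
an automorphism. -/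
theorem ModuliSpace.exists_map_galoisPoint_eq {E : WeierstrassCurve k} [E.IsElliptic]
    {v : F.obj (Torsion p (E.baseChange K))}
    (hx : ModuliSpace.mk (E.baseChange K) v ∈
      MulAction.fixedPoints (K ≃ₐ[k] K) (ModuliSpace F K)) (σ : K ≃ₐ[k] K) :
    ∃ (C : VariableChange K) (hC : C • E.baseChange K = E.baseChange K),
      F.map (torsionMap p (changeHom C hC)) (F.map (torsionMap p (galoisPoint E σ)) v) = v := by
  obtain ⟨C, hC, hv⟩ := Quotient.exact (hx σ)
  have hE : (E.baseChange K).map ((σ : K ≃+* K) : K →+* K) = E.baseChange K := by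
    ext <;> simp [WeierstrassCurve.baseChange]
  have hC' : C • (E.baseChange K).map ((σ : K ≃+* K) : K →+* K) = E.baseChange K := hC
  refine ⟨C, by rwa [hE] at hC', ?_⟩
  -- The two composites are compared on points, so `v` need not be transported along the equality
  -- `hE`.
  refine Eq.trans (map_map_eq _ _ _ _ (fun P => ?_) v) hv
  cases P <;> rfl

end Descent

end Necklace

/-! ### Conclusion for oriented and unoriented necklaces. -/

theorem mainTheorem11 (p : ℕ) [Fact p.Prime] (hp : p ≠ 2)
    (γ : (GaloisField p 2)ˣ) (hγ : ∀ x, x ∈ Subgroup.zpowers γ)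
    (k : Type*) [Field k] (hk : (p : k) ≠ 0)
    (K : Type*) [Field K] [DecidableEq K] [Algebra k K] [IsSepClosure k K] :
    (∀ x ∈ MulAction.fixedPoints (K ≃ₐ[k] K) (Necklace.ModuliSpace (Necklace.nsp (p := p) γ) K),
      (∃ (E : WeierstrassCurve k) (_ : E.IsElliptic)
        (v : Necklace.OrientedNecklace (γ : GaloisField p 2)
          (Necklace.Torsion p (E.baseChange K))),
        Necklace.ModuliSpace.mk (E.baseChange K) v = x) ∧
      ∀ (E : WeierstrassCurve k) [E.IsElliptic]
        (v : Necklace.OrientedNecklace (γ : GaloisField p 2)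
          (Necklace.Torsion p (E.baseChange K))),
        Necklace.ModuliSpace.mk (E.baseChange K) v = x → E.j ≠ 0 → E.j ≠ 1728 →
        (∀ σ : K ≃ₐ[k] K,
          Necklace.OrientedNecklace.map (Necklace.galoisRep p K E σ).toAddEquiv v = v) ∧
        ∃ H : Subgroup (Necklace.Torsion p (E.baseChange K) ≃ₗ[ZMod p]
            Necklace.Torsion p (E.baseChange K)),
          Necklace.IsNonsplitCartan H ∧ (Necklace.galoisRep p K E).range ≤ H) ∧
    (∀ x ∈ MulAction.fixedPoints (K ≃ₐ[k] K)
        (Necklace.ModuliSpace (Necklace.nspPlus (p := p) γ) K),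
      (∃ (E : WeierstrassCurve k) (_ : E.IsElliptic)
        (v : Necklace.UnorientedNecklace (γ : GaloisField p 2)
          (Necklace.Torsion p (E.baseChange K))),
        Necklace.ModuliSpace.mk (E.baseChange K) v = x) ∧
      ∀ (E : WeierstrassCurve k) [E.IsElliptic]
        (v : Necklace.UnorientedNecklace (γ : GaloisField p 2)
          (Necklace.Torsion p (E.baseChange K))),
        Necklace.ModuliSpace.mk (E.baseChange K) v = x → E.j ≠ 0 → E.j ≠ 1728 →
        (∀ σ : K ≃ₐ[k] K,
          Necklace.UnorientedNecklace.map (Necklace.galoisRep p K E σ).toAddEquiv v = v) ∧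
        ∃ H : Subgroup (Necklace.Torsion p (E.baseChange K) ≃ₗ[ZMod p]
            Necklace.Torsion p (E.baseChange K)),
          Necklace.IsNonsplitCartan H ∧ (Necklace.galoisRep p K E).range ≤ Subgroup.normalizer H) := by
  refine ⟨fun x hx => ⟨Necklace.ModuliSpace.exists_mk_baseChange_eq hx, ?_⟩,
    fun x hx => ⟨Necklace.ModuliSpace.exists_mk_baseChange_eq hx, ?_⟩⟩
  · rintro E hE v rfl h0 h1728
    have hfix : ∀ σ : K ≃ₐ[k] K,
        Necklace.OrientedNecklace.map (Necklace.galoisRep p K E σ).toAddEquiv v = v := fun σ => by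
      obtain ⟨C, hC, hv⟩ := Necklace.ModuliSpace.exists_map_galoisPoint_eq hx σ
      -- The automorphism is `±1`, so it fixes `σ(v)`; it also sends `σ(v)` to `v`.
      exact (Necklace.OrientedNecklace.map_eq_self
        (Necklace.torsionMap_changeHom_eq_or_eq_neg h0 h1728 C hC) _).symm.trans hv
    obtain ⟨H, hH, hv, -⟩ := v.exists_isNonsplitCartan hγ
    refine ⟨hfix, H, hH, ?_⟩
    rintro _ ⟨σ, rfl⟩
    exact hv _ (hfix σ)
  · rintro E hE v rfl h0 h1728
    have hfix : ∀ σ : K ≃ₐ[k] K,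
        Necklace.UnorientedNecklace.map (Necklace.galoisRep p K E σ).toAddEquiv v = v := fun σ => by
      obtain ⟨C, hC, hv⟩ := Necklace.ModuliSpace.exists_map_galoisPoint_eq hx σ
      exact (Necklace.UnorientedNecklace.map_eq_self
        (Necklace.torsionMap_changeHom_eq_or_eq_neg h0 h1728 C hC) _).symm.trans hv
    obtain ⟨H, hH, hv⟩ := v.exists_isNonsplitCartan hγ
    refine ⟨hfix, H, hH, ?_⟩
    rintro _ ⟨σ, rfl⟩
    exact hv _ (hfix σ)
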